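/- For an invertible real matrix $M\in\mathbb R^{3\times 3}$ let $H(M)$ be the linear distortion of $x\mapsto Mx$, where for $f:\mathbb R^3\to\mathbb R^3$ $$H(x,f)=\limsup_{r\to0^+}\frac{\max_{|x-y|=r}|f(x)-f(y)|}{\min_{|x-y|=r}|f(x)-f(y)|},\qquad H(f)=\|H(\cdot,f)\|_{L^\infty};$$ thus $H(M)$ is the ratio of the largest to the smallest singular value of $M$. Let $1<a<b$ and $A=\mathrm{diag}(1,a,b)$. For all unit vectors $u,v\in\mathbb R^3$ the function $t\mapsto H(A+t\,u\otimes v)$, where $u\otimes v=uv^{T}$, is smooth near $t=0$. Write $Q(u,v)=\frac12\frac{d^2}{dt^2}\big|_{t=0}H(A+t\,u\otimes v)$ for the coefficient of $t^2$ in its Taylor expansion at $0$, and call $(u,v)$ admissible if $\|u\|=\|v\|=1$ and $\frac{d}{dt}\big|_{t=0}H(A+t\,u\otimes v)=0$. Put $$u_1=\frac{b-1}{\sqrt{2(b+1)(1+a+a^2+b(a-1)+b^2)}},\quad u_2=\sqrt{\frac{1+2a^2+b^2+2a(1+b)}{2(1+a+a^2+b(a-1)+b^2)}},\quad u_3=\frac{(b-1)\sqrt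 b}{\sqrt{2(b+1)(1+a+a^2+b(a-1)+b^2)}}.$$ Then $u=(u_1,u_2,u_3)$, $v=(u_1,-u_2,u_3)$ is admissible, and the minimum of $Q$ over all admissible pairs is attained there, with value $$\min Q=Q(u,v)=\frac{-b(b-1)^3}{4(a+1)(b+1)(a+b)(1+a+a^2+ab-b+b^2)}<0.$$ The minimizing pair is unique up to signs: the admissible pairs at which $Q$ attains this minimum are exactly $$u=(\varepsilon_1u_1,\varepsilon_2u_2,\varepsilon_3u_3),\qquad v=\sigma\,(\varepsilon_1u_1,-\varepsilon_2u_2,\varepsilon_3u_3),\qquad \varepsilon_1,\varepsilon_2,\varepsilon_3,\sigma\in\{1,-1\}.$$ -/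

import Mathlib

open scoped ENNReal Topology ContDiff
open Filter MeasureTheory

noncomputable section

/-- The linear distortion `H(x,f)` of a map `f : ℝⁿ → ℝⁿ` at the point `x`: the upper limit, as
`r → 0⁺`, of the quotient of the maximum and the minimum of `|f x - f y|` over `|x - y| = r`.
It takes values in `[0,∞]`. -/
def linearDistortionAt {n : ℕ} (f : EuclideanSpace ℝ (Fin n) → EuclideanSpace ℝ (Fin n))
    (x : EuclideanSpace ℝ (Fin n)) : ℝ≥0∞ :=
  limsup (fun r : ℝ =>
      (⨆ y ∈ Metric.sphere x r, edist (f x) (f y)) /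
        (⨅ y ∈ Metric.sphere x r, edist (f x) (f y)))
    (𝓝[>] 0)

/-- The linear distortion `H(f)`, the `L^∞` norm of `x ↦ H(x,f)`. -/
def linearDistortion {n : ℕ} (f : EuclideanSpace ℝ (Fin n) → EuclideanSpace ℝ (Fin n)) : ℝ≥0∞ :=
  essSup (fun x => linearDistortionAt f x) volume

/-- The linear distortion `H(M)` of the linear map `x ↦ M x`, as a real number
(it is finite whenever `M` is invertible). -/
def matrixDistortion {n : ℕ} (M : Matrix (Fin n) (Fin n) ℝ) : ℝ :=
  (linearDistortion (fun x => Matrix.toEuclideanLin M x)).toReal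

/-- The function `t ↦ H(A + t B)` with `A = diag(1,a,b)` and `B = u ⊗ v = u vᵗ`. -/
def distortionAlong (a b : ℝ) (u v : EuclideanSpace ℝ (Fin 3)) (t : ℝ) : ℝ :=
  matrixDistortion (Matrix.diagonal ![1, a, b] + t • Matrix.vecMulVec (fun i => u i) (fun j => v j))

/-- The competing directions: unit vectors `u`, `v` for which the first derivative of
`t ↦ H(A + t (u ⊗ v))` at `t = 0` exists and is zero. -/
def IsAdmissible (a b : ℝ) (u v : EuclideanSpace ℝ (Fin 3)) : Prop :=
  ‖u‖ = 1 ∧ ‖v‖ = 1 ∧ HasDerivAt (distortionAlong a b u v) 0 0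

/-- The coefficient of `t ^ 2` in the Taylor expansion of `t ↦ H(A + t (u ⊗ v))` at `t = 0`. -/
def secondOrderCoeff (a b : ℝ) (u v : EuclideanSpace ℝ (Fin 3)) : ℝ :=
  iteratedDeriv 2 (distortionAlong a b u v) 0 / 2

/-- First coordinate of the extremal vectors. -/
def bestU₁ (a b : ℝ) : ℝ :=
  (b - 1) / √(2 * (b + 1) * (1 + a + a ^ 2 + b * (a - 1) + b ^ 2))

/-- Second coordinate, up to sign, of the extremal vectors. -/
def bestU₂ (a b : ℝ) : ℝ :=
  √((1 + 2 * a ^ 2 + b ^ 2 + 2 * a * (1 + b)) / (2 * (1 + a + a ^ 2 + b * (a - 1) + b ^ 2)))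

/-- Third coordinate of the extremal vectors. -/
def bestU₃ (a b : ℝ) : ℝ :=
  (b - 1) * √b / √(2 * (b + 1) * (1 + a + a ^ 2 + b * (a - 1) + b ^ 2))

/-- The minimum value of the second-order coefficient. -/
def minCoeff (a b : ℝ) : ℝ :=
  -b * (b - 1) ^ 3 /
    (4 * (a + 1) * (b + 1) * (a + b) * (1 + a + a ^ 2 + a * b - b + b ^ 2))

end

/-! With M = A + t u vᵀ, H(M)² is the quotient of the extreme eigenvalues of MᵀM. At t = 0 these
eigenvalues are 1 < a² < b², all simple, so they continue smoothly. Differentiating the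
characteristic equation twice gives H' = u₃v₃ - b u₁v₁. Hence admissibility means u₃v₃ = b u₁v₁, and
on such pairs the t² coefficient is `admissibleForm`, biquadratic in (u,v)
(`distortionAlong_taylor`).

Put p = |u₁v₁|, r = |u₂v₂| and s = u₁v₁u₂v₂. The arithmetic-geometric mean inequality bounds the
form below by a function of p, r, s alone (`reducedForm_le_admissibleForm`). Cauchy-Schwarz gives (1
+ b)p + r ≤ 1, and trivially s ≥ -pr. By `reducedForm_eq` the bound equals `minCoeff` plus positive
multiples of (p - `bestSq`)², pr + s and p(1 - (1 + b)p - r). Equality makes all three vanish. This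
fixes p and r, gives equality in Cauchy-Schwarz, so |uᵢ| = |vᵢ|, and leaves only the signs free. -/

/-! ### Distortion of a matrix as a ratio of singular values -/

theorem matrixDistortion_eq_div {n : ℕ} (M : Matrix (Fin n) (Fin n) ℝ) {c C : ℝ} (hc : 0 < c)
    (hlow : ∀ y, c * ‖y‖ ≤ ‖Matrix.toEuclideanLin M y‖)
    (hup : ∀ y, ‖Matrix.toEuclideanLin M y‖ ≤ C * ‖y‖)
    {f g : EuclideanSpace ℝ (Fin n)} (hf : ‖f‖ = 1) (hg : ‖g‖ = 1)
    (hcf : ‖Matrix.toEuclideanLin M f‖ = c) (hCg : ‖Matrix.toEuclideanLin M g‖ = C) :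
    matrixDistortion M = C / c := by
  have hC : 0 ≤ C := hCg ▸ norm_nonneg _
  have hdist : ∀ x y, edist (Matrix.toEuclideanLin M x) (Matrix.toEuclideanLin M y) =
      ENNReal.ofReal ‖Matrix.toEuclideanLin M (y - x)‖ := by
    intro x y
    rw [edist_comm, edist_dist, dist_eq_norm, map_sub]
  have hnorm : ∀ (e : EuclideanSpace ℝ (Fin n)) (r : ℝ), 0 < r →
      ‖Matrix.toEuclideanLin M (r • e)‖ = ‖Matrix.toEuclideanLin M e‖ * r := by
    intro e r hr
    rw [map_smul, norm_smul, Real.norm_of_nonneg hr.le, mul_comm]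
  have hmem : ∀ (x e : EuclideanSpace ℝ (Fin n)) (r : ℝ), 0 < r → ‖e‖ = 1 →
      x + r • e ∈ Metric.sphere x r := by
    intro x e r hr he
    simp [norm_smul, he, hr.le]
  have hpoint : ∀ x, linearDistortionAt (fun x => Matrix.toEuclideanLin M x) x =
      ENNReal.ofReal (C / c) := by
    intro x
    unfold linearDistortionAt
    -- By linearity the quotient does not depend on r > 0, so the upper limit is that of a constant.
    rw [← limsup_const (f := 𝓝[>] (0 : ℝ)) (ENNReal.ofReal (C / c))]
    refine limsup_congr ?_
    filter_upwards [self_mem_nhdsWithin] with r (hr : 0 < r)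
    have hsup : (⨆ y ∈ Metric.sphere x r,
        edist (Matrix.toEuclideanLin M x) (Matrix.toEuclideanLin M y)) =
        ENNReal.ofReal (C * r) := by
      refine le_antisymm (iSup₂_le fun y hy => ?_) ?_
      · rw [hdist]
        refine ENNReal.ofReal_le_ofReal ((hup _).trans_eq ?_)
        rw [mem_sphere_iff_norm.1 hy]
      · refine le_trans (le_of_eq ?_) (le_iSup₂ (x + r • g) (hmem x g r hr hg))
        rw [hdist, add_sub_cancel_left, hnorm g r hr, hCg]
    have hinf : (⨅ y ∈ Metric.sphere x r,
        edist (Matrix.toEuclideanLin M x) (Matrix.toEuclideanLin M y)) =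
        ENNReal.ofReal (c * r) := by
      refine le_antisymm ?_ (le_iInf₂ fun y hy => ?_)
      · refine le_trans (iInf₂_le (x + r • f) (hmem x f r hr hf)) (le_of_eq ?_)
        rw [hdist, add_sub_cancel_left, hnorm f r hr, hcf]
      · rw [hdist]
        refine ENNReal.ofReal_le_ofReal (le_of_eq_of_le ?_ (hlow _))
        rw [mem_sphere_iff_norm.1 hy]
    rw [hsup, hinf, ← ENNReal.ofReal_div_of_pos (mul_pos hc hr), mul_div_mul_right _ _ hr.ne']
  unfold matrixDistortion linearDistortion
  simp only [hpoint]
  rw [essSup_const _ (NeZero.ne _), ENNReal.toReal_ofReal (div_nonneg hC hc.le)]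

/-- The distortion of a matrix `M` for which `MᵀM` has three distinct positive eigenvalues. -/
theorem matrixDistortion_eq_sqrt (M : Matrix (Fin 3) (Fin 3) ℝ) {l : Fin 3 → ℝ}
    (h0 : 0 < l 0) (h01 : l 0 < l 1) (h12 : l 1 < l 2)
    (hl : ∀ i, (l i • (1 : Matrix (Fin 3) (Fin 3) ℝ) - M.transpose * M).det = 0) :
    matrixDistortion M = √(l 2) / √(l 0) := by
  set T := Matrix.toEuclideanLin M with hT
  have hadj : ∀ x y, inner ℝ (T x) (T y) =
      inner ℝ (Matrix.toEuclideanLin (M.transpose * M) x) y := by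
    intro x y
    simp [hT, PiLp.inner_apply, Matrix.toEuclideanLin, Matrix.toLpLin_apply, Matrix.mulVec,
      dotProduct, Fin.sum_univ_three, Matrix.mul_apply]
    ring
  have hex : ∀ i, ∃ e : EuclideanSpace ℝ (Fin 3), ‖e‖ = 1 ∧
      Matrix.toEuclideanLin (M.transpose * M) e = l i • e := by
    intro i
    obtain ⟨w, hw, hw'⟩ := Matrix.exists_mulVec_eq_zero_iff.2 (hl i)
    have hne : WithLp.toLp 2 w ≠ 0 := by simpa using hw
    have heig : Matrix.toEuclideanLin (M.transpose * M) (WithLp.toLp 2 w) =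
        l i • WithLp.toLp 2 w := by
      rw [Matrix.sub_mulVec, Matrix.smul_mulVec, Matrix.one_mulVec, sub_eq_zero] at hw'
      simp only [Matrix.toEuclideanLin, Matrix.toLpLin_apply, ← hw']
      rfl
    refine ⟨(‖WithLp.toLp 2 w‖⁻¹ : ℝ) • WithLp.toLp 2 w, norm_smul_inv_norm hne, ?_⟩
    rw [map_smul, heig, smul_comm]
  choose e he1 heig using hex
  have hinj : Function.Injective l := by
    intro i j hij
    fin_cases i <;> fin_cases j <;> simp at hij ⊢ <;> linarith
  have hon : Orthonormal ℝ e := by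
    refine ⟨he1, fun i j hij => ?_⟩
    have h1 := hadj (e i) (e j)
    have h2 := hadj (e j) (e i)
    rw [heig, real_inner_smul_left] at h1 h2
    rw [real_inner_comm, h1, real_inner_comm] at h2
    have : (l i - l j) * inner ℝ (e j) (e i) = 0 := by linarith
    change inner ℝ (e i) (e j) = 0
    rw [real_inner_comm]
    exact (mul_eq_zero.1 this).resolve_left (sub_ne_zero.2 fun h => hij (hinj h))
  let B : OrthonormalBasis (Fin 3) ℝ (EuclideanSpace ℝ (Fin 3)) :=
    OrthonormalBasis.mk hon (hon.linearIndependent.span_eq_top_of_card_eq_finrank'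
      (by simp)).ge
  have hB : ∀ i, B i = e i := fun i => by simp [B]
  have hpars : ∀ y, ‖y‖ ^ 2 = ∑ i, inner ℝ (e i) y ^ 2 := by
    intro y
    rw [← B.sum_sq_norm_inner_right y]
    simp [hB]
  -- In the orthonormal eigenbasis of MᵀM, ‖T y‖² is a combination of the `l i` weighted by squared
  -- coordinates, so `l 0` and `l 2` are its extremes on the unit sphere.
  have hsq : ∀ y, ‖T y‖ ^ 2 = ∑ i, l i * inner ℝ (e i) y ^ 2 := by
    intro y
    rw [← real_inner_self_eq_norm_sq, hadj, ← B.sum_inner_mul_inner]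
    refine Finset.sum_congr rfl fun i _ => ?_
    rw [hB, ← hadj, real_inner_comm, hadj, heig, real_inner_smul_left]
    ring
  have hTe : ∀ i, 0 < l i → ‖T (e i)‖ = √(l i) := by
    intro i hi
    rw [← Real.sqrt_sq (norm_nonneg (T (e i))), ← real_inner_self_eq_norm_sq, hadj, heig,
      real_inner_smul_left, real_inner_self_eq_norm_sq, he1]
    simp
  refine matrixDistortion_eq_div M (Real.sqrt_pos.2 h0) (fun y => ?_) (fun y => ?_)
    (he1 0) (he1 2) (hTe 0 h0) (hTe 2 (by linarith))
  · refine (sq_le_sq₀ (by positivity) (norm_nonneg _)).1 ?_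
    rw [mul_pow, Real.sq_sqrt h0.le, hsq, hpars, Finset.mul_sum]
    refine Finset.sum_le_sum fun i _ => mul_le_mul_of_nonneg_right ?_ (sq_nonneg _)
    fin_cases i <;> simp <;> linarith
  · refine (sq_le_sq₀ (norm_nonneg _) (by positivity)).1 ?_
    rw [mul_pow, Real.sq_sqrt (by linarith), hsq, hpars, Finset.mul_sum]
    refine Finset.sum_le_sum fun i _ => mul_le_mul_of_nonneg_right ?_ (sq_nonneg _)
    fin_cases i <;> simp <;> linarith

/-! ### Smooth root branches and implicit differentiation -/

/-- A simple root of a polynomial continues smoothly under a quadratic perturbation. -/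
theorem exists_contDiffAt_root (P0 P1 P2 : Polynomial ℝ) {x0 : ℝ} (h0 : P0.eval x0 = 0)
    (h1 : P0.derivative.eval x0 ≠ 0) :
    ∃ x : ℝ → ℝ, ContDiffAt ℝ ∞ x 0 ∧ x 0 = x0 ∧
      ∀ᶠ t in 𝓝 (0 : ℝ), P0.eval (x t) + t * P1.eval (x t) + t ^ 2 * P2.eval (x t) = 0 := by
  have hP : ∀ P : Polynomial ℝ, ContDiff ℝ ∞ fun x : ℝ => P.eval x := fun P => by
    simpa using P.contDiff_aeval (𝕜 := ℝ) ∞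
  let f : ℝ × ℝ → ℝ := fun q => P0.eval q.2 + q.1 * P1.eval q.2 + q.1 ^ 2 * P2.eval q.2
  have hf : ContDiff ℝ ∞ f := by
    have h0 := (hP P0).comp (contDiff_snd (E := ℝ) (F := ℝ))
    have h1 := (hP P1).comp (contDiff_snd (E := ℝ) (F := ℝ))
    have h2 := (hP P2).comp (contDiff_snd (E := ℝ) (F := ℝ))
    exact (h0.add (contDiff_fst.mul h1)).add ((contDiff_fst.pow 2).mul h2)
  have hcd : ContDiffAt ℝ ∞ f (0, x0) := hf.contDiffAt
  -- At t = 0 the terms with `P1` and `P2` drop out, so the partial derivative in x is P0'(x0),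
  -- nonzero because the root is simple.
  have hinv : (fderiv ℝ f (0, x0) ∘L .inr ℝ ℝ ℝ).IsInvertible := by
    refine ⟨ContinuousLinearEquiv.unitsEquivAut ℝ (Units.mk0 _ h1), ?_⟩
    have hd : HasFDerivAt f (fderiv ℝ f (0, x0)) (0, x0) :=
      (hcd.differentiableAt (by simp)).hasFDerivAt
    have hc : HasDerivAt (fun x : ℝ => f (0, x)) (fderiv ℝ f (0, x0) (0, 1)) x0 :=
      hd.comp_hasDerivAt x0 ((hasDerivAt_const x0 (0 : ℝ)).prodMk (hasDerivAt_id x0))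
    have hc' : HasDerivAt (fun x : ℝ => f (0, x)) (P0.derivative.eval x0) x0 := by
      simpa [f] using P0.hasDerivAt x0
    ext
    simp [← hc.unique hc']
  refine ⟨hcd.implicitFunction (by simp) hinv, hcd.contDiffAt_implicitFunction (by simp) hinv,
    hcd.implicitFunction_apply_self (by simp) hinv, ?_⟩
  filter_upwards [hcd.eventually_apply_implicitFunction (by simp) hinv] with t ht
  simpa [f, h0] using ht

theorem ContDiffAt.eventually_hasDerivAt_infty {x : ℝ → ℝ} {s : ℝ} (hx : ContDiffAt ℝ ∞ x s) :
    (∀ᶠ t in 𝓝 s, HasDerivAt x (deriv x t) t) ∧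
      HasDerivAt (deriv x) (iteratedDeriv 2 x s) s := by
  have h2 : ContDiffAt ℝ 2 x s := hx.of_le (WithTop.coe_le_coe.2 (le_top : (2 : ℕ∞) ≤ ⊤))
  refine ⟨?_, ?_⟩
  · filter_upwards [h2.eventually (by simp)] with t ht
    exact (ht.differentiableAt (by simp)).hasDerivAt
  · rw [iteratedDeriv_succ, iteratedDeriv_one]
    have : ContDiffAt ℝ 1 (deriv x) s := h2.derivWithin (by norm_num)
    exact (this.differentiableAt (by simp)).hasDerivAt

theorem root_deriv_relations (P0 P1 P2 : Polynomial ℝ) {x : ℝ → ℝ} (hx : ContDiffAt ℝ ∞ x 0)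
    (h : ∀ᶠ t in 𝓝 (0 : ℝ), P0.eval (x t) + t * P1.eval (x t) + t ^ 2 * P2.eval (x t) = 0) :
    P0.derivative.eval (x 0) * deriv x 0 + P1.eval (x 0) = 0 ∧
    P0.derivative.derivative.eval (x 0) * deriv x 0 ^ 2
      + P0.derivative.eval (x 0) * iteratedDeriv 2 x 0
      + 2 * P1.derivative.eval (x 0) * deriv x 0 + 2 * P2.eval (x 0) = 0 := by
  obtain ⟨hd1, hd2⟩ := hx.eventually_hasDerivAt_infty
  have hcomp : ∀ (P : Polynomial ℝ) {t : ℝ}, HasDerivAt x (deriv x t) t →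
      HasDerivAt (fun t => P.eval (x t)) (P.derivative.eval (x t) * deriv x t) t :=
    fun P t ht => (P.hasDerivAt (x t)).comp t ht
  -- The unsimplified shape is the literal output of the product rule, so that the identity can be
  -- differentiated once more.
  have hfirst : ∀ᶠ t in 𝓝 (0 : ℝ), P0.derivative.eval (x t) * deriv x t
      + (1 * P1.eval (x t) + t * (P1.derivative.eval (x t) * deriv x t))
      + ((2 : ℕ) * t ^ (2 - 1) * P2.eval (x t)
        + t ^ 2 * (P2.derivative.eval (x t) * deriv x t)) = 0 := by
    filter_upwards [hd1, h.eventually_nhds] with t ht hz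
    have := ((hcomp P0 ht).add ((hasDerivAt_id t).mul (hcomp P1 ht))).add
      ((hasDerivAt_pow 2 t).mul (hcomp P2 ht))
    exact this.unique ((hasDerivAt_const t (0 : ℝ)).congr_of_eventuallyEq hz)
  have h0 := hd1.self_of_nhds
  refine ⟨by simpa using hfirst.self_of_nhds, ?_⟩
  have hsecond := (((hcomp P0.derivative h0).mul hd2).add
    (((hcomp P1 h0).const_mul 1).add ((hasDerivAt_id (0 : ℝ)).mul
      ((hcomp P1.derivative h0).mul hd2)))).add
    (((((hasDerivAt_pow (2 - 1) (0 : ℝ)).const_mul ((2 : ℕ) : ℝ))).mul (hcomp P2 h0)).add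
      ((hasDerivAt_pow 2 (0 : ℝ)).mul ((hcomp P2.derivative h0).mul hd2)))
  have := hsecond.unique ((hasDerivAt_const (0 : ℝ) (0 : ℝ)).congr_of_eventuallyEq hfirst)
  simp at this
  linarith

/-- Applied to H = √z / √x in the form H² x = z, this avoids differentiating square roots and
quotients. -/
theorem deriv_relations_of_sq_mul_eq {H x z : ℝ → ℝ} (hH : ContDiffAt ℝ ∞ H 0)
    (hx : ContDiffAt ℝ ∞ x 0) (hz : ContDiffAt ℝ ∞ z 0)
    (h : ∀ᶠ t in 𝓝 (0 : ℝ), H t ^ 2 * x t = z t) :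
    2 * H 0 * deriv H 0 * x 0 + H 0 ^ 2 * deriv x 0 = deriv z 0 ∧
    2 * deriv H 0 ^ 2 * x 0 + 2 * H 0 * iteratedDeriv 2 H 0 * x 0
      + 4 * H 0 * deriv H 0 * deriv x 0 + H 0 ^ 2 * iteratedDeriv 2 x 0
      = iteratedDeriv 2 z 0 := by
  obtain ⟨hH1, hH2⟩ := hH.eventually_hasDerivAt_infty
  obtain ⟨hx1, hx2⟩ := hx.eventually_hasDerivAt_infty
  obtain ⟨hz1, hz2⟩ := hz.eventually_hasDerivAt_infty
  have hfirst : ∀ᶠ t in 𝓝 (0 : ℝ),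
      2 * (H t * deriv H t) * x t + H t ^ 2 * deriv x t = deriv z t := by
    filter_upwards [hH1, hx1, hz1, h.eventually_nhds] with t h1 h2 h3 h4
    have := ((h1.pow 2).mul h2).unique (h3.congr_of_eventuallyEq h4)
    simp at this
    linarith
  refine ⟨by linarith [hfirst.self_of_nhds], ?_⟩
  have h1 := hH1.self_of_nhds
  have h2 := hx1.self_of_nhds
  have := ((((h1.mul hH2).const_mul 2).mul h2).add ((h1.pow 2).mul hx2)).unique
    (hz2.congr_of_eventuallyEq hfirst)
  simp at this
  linarith

/-! ### The characteristic polynomial of the Gram matrix -/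

/-- The characteristic polynomial of `diag(1,a,b)ᵗ diag(1,a,b)`. -/
noncomputable def gramPoly₀ (a b : ℝ) : Polynomial ℝ :=
  (Polynomial.X - Polynomial.C 1) * (Polynomial.X - Polynomial.C (a ^ 2)) *
    (Polynomial.X - Polynomial.C (b ^ 2))

/-- The coefficient of `t` in `det (x - MᵗM)`, `M = diag(1,a,b) + t u vᵗ`. -/
noncomputable def gramPoly₁ (a b u₁ u₂ u₃ v₁ v₂ v₃ : ℝ) : Polynomial ℝ :=
  Polynomial.C (-2 * (u₁ * v₁)) *
      ((Polynomial.X - Polynomial.C (a ^ 2)) * (Polynomial.X - Polynomial.C (b ^ 2))) +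
    Polynomial.C (-2 * (a * u₂ * v₂)) *
      ((Polynomial.X - Polynomial.C 1) * (Polynomial.X - Polynomial.C (b ^ 2))) +
    Polynomial.C (-2 * (b * u₃ * v₃)) *
      ((Polynomial.X - Polynomial.C 1) * (Polynomial.X - Polynomial.C (a ^ 2)))

/-- The coefficient of `t ^ 2` in `det (x - MᵗM)`, `M = diag(1,a,b) + t u vᵗ`, `|u| = 1`. -/
noncomputable def gramPoly₂ (a b u₁ u₂ u₃ v₁ v₂ v₃ : ℝ) : Polynomial ℝ :=
  Polynomial.C (-v₁ ^ 2) *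
      ((Polynomial.X - Polynomial.C (a ^ 2)) * (Polynomial.X - Polynomial.C (b ^ 2))) +
    Polynomial.C (-v₂ ^ 2) *
      ((Polynomial.X - Polynomial.C 1) * (Polynomial.X - Polynomial.C (b ^ 2))) +
    Polynomial.C (-v₃ ^ 2) *
      ((Polynomial.X - Polynomial.C 1) * (Polynomial.X - Polynomial.C (a ^ 2))) +
    Polynomial.C (-(v₁ * (a * u₂) - v₂ * u₁) ^ 2) * (Polynomial.X - Polynomial.C (b ^ 2)) +
    Polynomial.C (-(v₁ * (b * u₃) - v₃ * u₁) ^ 2) * (Polynomial.X - Polynomial.C (a ^ 2)) +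
    Polynomial.C (-(v₂ * (b * u₃) - v₃ * (a * u₂)) ^ 2) * (Polynomial.X - Polynomial.C 1)

/-- Since |u| = 1, MᵀM - A² = t(v(Au)ᵀ + (Au)vᵀ) + t² v vᵀ. Its range lies in the span of v and Au,
so the determinant has no terms beyond t²; the 2 × 2 minors of (v, Au) enter as squares. -/
theorem det_smul_one_sub_gram (a b x t : ℝ) (u v : Fin 3 → ℝ)
    (hu : u 0 ^ 2 + u 1 ^ 2 + u 2 ^ 2 = 1) :
    (x • (1 : Matrix (Fin 3) (Fin 3) ℝ) -
      (Matrix.diagonal ![1, a, b] + t • Matrix.vecMulVec u v).transpose *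
        (Matrix.diagonal ![1, a, b] + t • Matrix.vecMulVec u v)).det =
    (gramPoly₀ a b).eval x
      + t * (gramPoly₁ a b (u 0) (u 1) (u 2) (v 0) (v 1) (v 2)).eval x
      + t ^ 2 * (gramPoly₂ a b (u 0) (u 1) (u 2) (v 0) (v 1) (v 2)).eval x := by
  have hG : (Matrix.diagonal ![1, a, b] + t • Matrix.vecMulVec u v).transpose *
        (Matrix.diagonal ![1, a, b] + t • Matrix.vecMulVec u v) =
      Matrix.of fun i j => Matrix.diagonal ![1, a ^ 2, b ^ 2] i j
        + t * (v i * (![1, a, b] j * u j) + ![1, a, b] i * u i * v j) + t ^ 2 * (v i * v j) := by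
    ext i j
    rw [Matrix.mul_apply]
    fin_cases i <;> fin_cases j <;>
      simp [Fin.sum_univ_three, Matrix.vecMulVec_apply] <;>
      first
      | linear_combination (t ^ 2 * v 0 * v 0) * hu
      | linear_combination (t ^ 2 * v 0 * v 1) * hu
      | linear_combination (t ^ 2 * v 0 * v 2) * hu
      | linear_combination (t ^ 2 * v 1 * v 1) * hu
      | linear_combination (t ^ 2 * v 1 * v 2) * hu
      | linear_combination (t ^ 2 * v 2 * v 2) * hu
  rw [hG, Matrix.det_fin_three]
  simp [gramPoly₀, gramPoly₁, gramPoly₂]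
  ring

/-! ### Taylor expansion of the distortion -/

/-- The second-order coefficient of the distortion on admissible directions. -/
noncomputable def admissibleForm (a b u₁ u₂ u₃ v₁ v₂ v₃ : ℝ) : ℝ :=
  (2 * b * (v₃ ^ 2 * u₁ ^ 2 + u₃ ^ 2 * v₁ ^ 2) + 2 * (1 + b ^ 2) * (u₁ * v₁ * (u₃ * v₃)))
      / (2 * (b ^ 2 - 1))
    + (b * (v₃ ^ 2 * u₂ ^ 2 + u₃ ^ 2 * v₂ ^ 2) + 2 * a * (u₂ * v₂ * (u₃ * v₃)))
      / (2 * (b ^ 2 - a ^ 2))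
    + b * ((v₁ ^ 2 * u₂ ^ 2 + u₁ ^ 2 * v₂ ^ 2) + 2 * a * (u₁ * v₁ * (u₂ * v₂)))
      / (2 * (a ^ 2 - 1))

/-- The three roots of `gramPoly₀` are distinct, hence simple, and the strict order 0 < 1 < a² < b²
persists near t = 0 by continuity. -/
theorem exists_root_branches {a b : ℝ} (ha : 1 < a) (hab : a < b) (P1 P2 : Polynomial ℝ) :
    ∃ l : Fin 3 → ℝ → ℝ, (∀ i, ContDiffAt ℝ ∞ (l i) 0) ∧
      l 0 0 = 1 ∧ l 1 0 = a ^ 2 ∧ l 2 0 = b ^ 2 ∧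
      (∀ i, ∀ᶠ t in 𝓝 (0 : ℝ), (gramPoly₀ a b).eval (l i t) + t * P1.eval (l i t)
        + t ^ 2 * P2.eval (l i t) = 0) ∧
      ∀ᶠ t in 𝓝 (0 : ℝ), 0 < l 0 t ∧ l 0 t < l 1 t ∧ l 1 t < l 2 t := by
  have h1 : a ^ 2 - 1 ≠ 0 := by nlinarith
  have h2 : b ^ 2 - 1 ≠ 0 := by nlinarith
  have h3 : b ^ 2 - a ^ 2 ≠ 0 := by nlinarith
  obtain ⟨x, hx, hx0, hxe⟩ := exists_contDiffAt_root (gramPoly₀ a b) P1 P2 (x0 := 1)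
    (by simp [gramPoly₀]) (by
      simp [gramPoly₀, Polynomial.derivative_mul,
      Polynomial.derivative_pow]
      exact ⟨fun h => h1 (by linarith), fun h => h2 (by linarith)⟩)
  obtain ⟨y, hy, hy0, hye⟩ := exists_contDiffAt_root (gramPoly₀ a b) P1 P2 (x0 := a ^ 2)
    (by simp [gramPoly₀]) (by
      simp [gramPoly₀, Polynomial.derivative_mul,
      Polynomial.derivative_pow]
      exact ⟨h1, fun h => h3 (by linarith)⟩)
  obtain ⟨z, hz, hz0, hze⟩ := exists_contDiffAt_root (gramPoly₀ a b) P1 P2 (x0 := b ^ 2)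
    (by simp [gramPoly₀]) (by
      simp [gramPoly₀, Polynomial.derivative_mul,
      Polynomial.derivative_pow]
      exact ⟨h2, h3⟩)
  refine ⟨![x, y, z], ?_, hx0, hy0, hz0, ?_, ?_⟩
  · intro i; fin_cases i <;> assumption
  · intro i; fin_cases i <;> assumption
  · have e1 := (continuousAt_const (y := (0 : ℝ))).eventually_lt hx.continuousAt
      (by rw [hx0]; exact one_pos)
    have e2 := hx.continuousAt.eventually_lt hy.continuousAt (by rw [hx0, hy0]; nlinarith)
    have e3 := hy.continuousAt.eventually_lt hz.continuousAt (by rw [hy0, hz0]; nlinarith)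
    exact e1.and (e2.and e3)

theorem sq_sum_eq_one {u : EuclideanSpace ℝ (Fin 3)} (hu : ‖u‖ = 1) :
    u 0 ^ 2 + u 1 ^ 2 + u 2 ^ 2 = 1 := by
  have := EuclideanSpace.real_norm_sq_eq u
  rw [hu, Fin.sum_univ_three] at this
  linarith

theorem distortionAlong_taylor {a b : ℝ} (ha : 1 < a) (hab : a < b)
    {u v : EuclideanSpace ℝ (Fin 3)} (hu : ‖u‖ = 1) :
    ContDiffAt ℝ ∞ (distortionAlong a b u v) 0 ∧
    deriv (distortionAlong a b u v) 0 = u 2 * v 2 - b * (u 0 * v 0) ∧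
    (u 2 * v 2 = b * (u 0 * v 0) → secondOrderCoeff a b u v =
      admissibleForm a b (u 0) (u 1) (u 2) (v 0) (v 1) (v 2)) := by
  have hu' := sq_sum_eq_one hu
  have h1 : a ^ 2 - 1 ≠ 0 := by nlinarith
  have h2 : b ^ 2 - 1 ≠ 0 := by nlinarith
  have h3 : b ^ 2 - a ^ 2 ≠ 0 := by nlinarith
  have hb : 0 < b := by linarith
  obtain ⟨l, hl, hl0, hl1, hl2, hroot, hord⟩ := exists_root_branches ha hab
    (gramPoly₁ a b (u 0) (u 1) (u 2) (v 0) (v 1) (v 2))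
    (gramPoly₂ a b (u 0) (u 1) (u 2) (v 0) (v 1) (v 2))
  have heq : distortionAlong a b u v =ᶠ[𝓝 0] fun t => √(l 2 t) / √(l 0 t) := by
    filter_upwards [hord, eventually_all.2 hroot] with t ⟨ht0, ht1, ht2⟩ ht
    refine matrixDistortion_eq_sqrt _ (l := fun i => l i t) ht0 ht1 ht2 fun i => ?_
    rw [det_smul_one_sub_gram a b (l i t) t _ _ hu', ht i]
  have hH : ContDiffAt ℝ ∞ (distortionAlong a b u v) 0 := by
    refine ContDiffAt.congr_of_eventuallyEq ?_ heq
    refine ((hl 2).sqrt ?_).div ((hl 0).sqrt ?_) ?_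
    · rw [hl2]; positivity
    · rw [hl0]; exact one_ne_zero
    · rw [hl0]; simp
  have hH0 : distortionAlong a b u v 0 = b := by
    rw [heq.self_of_nhds]
    simp [hl2, hl0, Real.sqrt_sq hb.le]
  obtain ⟨r1, r2⟩ := deriv_relations_of_sq_mul_eq hH (hl 0) (hl 2) (by
    filter_upwards [hord, heq] with t ⟨ht0, ht1, ht2⟩ ht
    rw [ht, div_pow, Real.sq_sqrt (by linarith), Real.sq_sqrt ht0.le,
      div_mul_cancel₀ _ ht0.ne'])
  obtain ⟨p1, p2⟩ := root_deriv_relations _ _ _ (hl 0) (hroot 0)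
  obtain ⟨q1, q2⟩ := root_deriv_relations _ _ _ (hl 2) (hroot 2)
  rw [hH0, hl0] at r1 r2
  rw [hl0] at p1 p2
  rw [hl2] at q1 q2
  have hx : deriv (l 0) 0 = 2 * (u 0 * v 0) := by
    simp [gramPoly₀, gramPoly₁, Polynomial.derivative_mul,
      Polynomial.derivative_pow] at p1
    refine mul_left_cancel₀ (mul_ne_zero h1 h2) ?_
    linear_combination p1
  have hz : deriv (l 2) 0 = 2 * (b * (u 2 * v 2)) := by
    simp [gramPoly₀, gramPoly₁, Polynomial.derivative_mul,
      Polynomial.derivative_pow] at q1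
    refine mul_left_cancel₀ (mul_ne_zero h3 h2) ?_
    linear_combination q1
  have hd : deriv (distortionAlong a b u v) 0 = u 2 * v 2 - b * (u 0 * v 0) := by
    rw [hx, hz] at r1
    refine mul_left_cancel₀ (mul_ne_zero two_ne_zero hb.ne') ?_
    linear_combination r1
  refine ⟨hH, hd, fun hadm => ?_⟩
  have hd0 : deriv (distortionAlong a b u v) 0 = 0 := by rw [hd, hadm, sub_self]
  rw [hx] at p2
  rw [hz] at q2
  -- Second-order perturbation theory: a diagonal entry of the t² term plus squared off-diagonal
  -- entries of the t term over eigenvalue gaps.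
  have hx2 : iteratedDeriv 2 (l 0) 0 / 2 = v 0 ^ 2
      - (u 0 * v 1 + a * u 1 * v 0) ^ 2 / (a ^ 2 - 1)
      - (u 0 * v 2 + b * u 2 * v 0) ^ 2 / (b ^ 2 - 1) := by
    simp [gramPoly₀, gramPoly₁, gramPoly₂, Polynomial.derivative_mul,
      Polynomial.derivative_pow] at p2
    field_simp
    linear_combination p2
  have hz2 : iteratedDeriv 2 (l 2) 0 / 2 = v 2 ^ 2
      + (b * u 2 * v 0 + u 0 * v 2) ^ 2 / (b ^ 2 - 1)
      + (b * u 2 * v 1 + a * u 1 * v 2) ^ 2 / (b ^ 2 - a ^ 2) := by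
    simp [gramPoly₀, gramPoly₁, gramPoly₂, Polynomial.derivative_mul,
      Polynomial.derivative_pow] at q2
    field_simp
    linear_combination q2
  -- With H' = 0 the cross terms vanish, leaving 2b H'' + b² x'' = z''.
  rw [hd0] at r2
  have hQ : secondOrderCoeff a b u v =
      (iteratedDeriv 2 (l 2) 0 / 2 - b ^ 2 * (iteratedDeriv 2 (l 0) 0 / 2)) / (2 * b) := by
    unfold secondOrderCoeff
    field_simp
    linear_combination r2
  rw [hQ, hx2, hz2, admissibleForm]
  have hu0 : u 2 ^ 2 * v 2 ^ 2 = b ^ 2 * (u 0 ^ 2 * v 0 ^ 2) := by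
    linear_combination (u 2 * v 2 + b * (u 0 * v 0)) * hadm
  have e0 : v 0 ^ 2 = v 0 ^ 2 * (u 0 ^ 2 + u 1 ^ 2 + u 2 ^ 2) := by rw [hu', mul_one]
  have e2 : v 2 ^ 2 = v 2 ^ 2 * (u 0 ^ 2 + u 1 ^ 2 + u 2 ^ 2) := by rw [hu', mul_one]
  -- Multiplying by |u|² = 1 makes the expression biquadratic; the terms u₃²v₃² and b²u₁²v₁² then
  -- cancel by admissibility.
  have key : v 2 ^ 2 - b ^ 2 * v 0 ^ 2 = v 2 ^ 2 * (u 0 ^ 2 + u 1 ^ 2)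
      - b ^ 2 * (v 0 ^ 2 * (u 1 ^ 2 + u 2 ^ 2)) := by
    linear_combination e2 - b ^ 2 * e0 + hu0
  field_simp
  linear_combination (b ^ 2 - 1) * (b ^ 2 - a ^ 2) * (a ^ 2 - 1) * key

/-! ### The extremal vectors and the minimum value -/

/-- The square of the first coordinate of the extremal vectors. -/
noncomputable def bestSq (a b : ℝ) : ℝ :=
  (b - 1) ^ 2 / (2 * (b + 1) * (1 + a + a ^ 2 + b * (a - 1) + b ^ 2))

theorem bestDenom_pos {a b : ℝ} (ha : 1 < a) (hab : a < b) :
    0 < 1 + a + a ^ 2 + b * (a - 1) + b ^ 2 := by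
  have : 0 < b * (a - 1) := mul_pos (by linarith) (by linarith)
  positivity

theorem bestSq_pos {a b : ℝ} (ha : 1 < a) (hab : a < b) : 0 < bestSq a b := by
  have := bestDenom_pos ha hab
  have hb : 0 < b := by linarith
  have : 0 < b - 1 := by linarith
  unfold bestSq
  positivity

theorem bestU₁_sq {a b : ℝ} (ha : 1 < a) (hab : a < b) : bestU₁ a b ^ 2 = bestSq a b := by
  have := bestDenom_pos ha hab
  have hb : 0 < b := by linarith
  rw [bestU₁, bestSq, div_pow, Real.sq_sqrt (by positivity)]

theorem bestU₃_sq {a b : ℝ} (ha : 1 < a) (hab : a < b) : bestU₃ a b ^ 2 = b * bestSq a b := by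
  have := bestDenom_pos ha hab
  have hb : 0 < b := by linarith
  rw [bestU₃, bestSq, div_pow, mul_pow, Real.sq_sqrt hb.le, Real.sq_sqrt (by positivity)]
  ring

theorem bestU₂_sq {a b : ℝ} (ha : 1 < a) (hab : a < b) :
    bestU₂ a b ^ 2 = 1 - (1 + b) * bestSq a b := by
  have := bestDenom_pos ha hab
  have hb : 0 < b := by linarith
  have hb1 : b + 1 ≠ 0 := by linarith
  rw [bestU₂, bestSq, Real.sq_sqrt (by positivity)]
  field_simp
  ring

theorem bestU_pos {a b : ℝ} (ha : 1 < a) (hab : a < b) :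
    0 < bestU₁ a b ∧ 0 < bestU₂ a b ∧ 0 < bestU₃ a b := by
  have := bestDenom_pos ha hab
  have hb : 0 < b := by linarith
  have hb1 : 0 < b - 1 := by linarith
  refine ⟨?_, ?_, ?_⟩
  · unfold bestU₁; positivity
  · unfold bestU₂; positivity
  · unfold bestU₃; positivity

theorem minCoeff_neg {a b : ℝ} (ha : 1 < a) (hab : a < b) : minCoeff a b < 0 := by
  have h := bestDenom_pos ha hab
  have h' : 0 < 1 + a + a ^ 2 + a * b - b + b ^ 2 := by linarith
  have hb : 0 < b := by linarith
  have hb1 : 0 < b - 1 := by linarith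
  unfold minCoeff
  rw [neg_mul, neg_div]
  exact neg_neg_of_pos (by positivity)

/-! ### The sharp lower bound -/

/-- The part of `admissibleForm` that remains after the arithmetic-geometric mean inequality:
`p = |u₁v₁|`, `r = |u₂v₂|`, `s = u₁v₁u₂v₂`. -/
noncomputable def reducedForm (a b p r s : ℝ) : ℝ :=
  (4 * b ^ 2 * p ^ 2 + 2 * (1 + b ^ 2) * (b * p ^ 2)) / (2 * (b ^ 2 - 1))
    + (2 * b ^ 2 * (p * r) + 2 * a * b * s) / (2 * (b ^ 2 - a ^ 2))
    + b * (2 * (p * r) + 2 * a * s) / (2 * (a ^ 2 - 1))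

/-- With s = -pr and r = 1 - (1 + b)p the form becomes a quadratic in p. Its vertex is `bestSq` and
its minimum is `minCoeff`; the last two summands measure the deviation from these two equalities. -/
theorem reducedForm_eq {a b : ℝ} (ha : 1 < a) (hab : a < b) (p r s : ℝ) :
    reducedForm a b p r s = minCoeff a b
      + b * (b + 1) * (1 + a + a ^ 2 + b * (a - 1) + b ^ 2) / ((b - 1) * ((a + b) * (a + 1)))
        * (p - bestSq a b) ^ 2
      + (a * b / (b ^ 2 - a ^ 2) + a * b / (a ^ 2 - 1)) * (p * r + s)
      + b * (b - 1) / ((a + b) * (a + 1)) * (p * (1 - (1 + b) * p - r)) := by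
  have hN := bestDenom_pos ha hab
  have hN' : 0 < 1 + a + a ^ 2 + a * b - b + b ^ 2 := by linarith
  have hb : 0 < b := by linarith
  have hb1 : b - 1 ≠ 0 := by linarith
  have hb2 : b + 1 ≠ 0 := by linarith
  have ha1 : a - 1 ≠ 0 := by linarith
  have ha2 : a + 1 ≠ 0 := by linarith
  have h1 : a + b ≠ 0 := by linarith
  have h2 : b - a ≠ 0 := by linarith
  have e1 : b ^ 2 - 1 = (b - 1) * (b + 1) := by ring
  have e2 : a ^ 2 - 1 = (a - 1) * (a + 1) := by ring
  have e3 : b ^ 2 - a ^ 2 = (b - a) * (a + b) := by ring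
  have e4 : 1 + a + a ^ 2 + a * b - b + b ^ 2 = 1 + a + a ^ 2 + b * (a - 1) + b ^ 2 := by ring
  have hq : b * (b + 1) * (1 + a + a ^ 2 + b * (a - 1) + b ^ 2) /
        ((b - 1) * ((a + b) * (a + 1))) * (p - bestSq a b) ^ 2
      = b * (b + 1) * (1 + a + a ^ 2 + b * (a - 1) + b ^ 2) /
        ((b - 1) * ((a + b) * (a + 1))) * p ^ 2
        - b * (b - 1) / ((a + b) * (a + 1)) * p - minCoeff a b := by
    rw [minCoeff, bestSq, e4]
    generalize hg : 1 + a + a ^ 2 + b * (a - 1) + b ^ 2 = N at *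
    field_simp
    ring
  rw [hq, reducedForm, e1, e2, e3]
  field_simp
  ring

/-- Each sum vᵢ²uⱼ² + uᵢ²vⱼ² is at least 2|uᵢvᵢ||uⱼvⱼ|, and |u₃v₃| = b|u₁v₁| eliminates the third
product. -/
theorem reducedForm_le_admissibleForm {a b : ℝ} (ha : 1 < a) (hab : a < b)
    {u₁ u₂ u₃ v₁ v₂ v₃ : ℝ} (h : u₃ * v₃ = b * (u₁ * v₁)) :
    reducedForm a b |u₁ * v₁| |u₂ * v₂| (u₁ * v₁ * (u₂ * v₂)) ≤
      admissibleForm a b u₁ u₂ u₃ v₁ v₂ v₃ := by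
  have hb : 0 < b := by linarith
  have h1 : 0 < a ^ 2 - 1 := by nlinarith
  have h2 : 0 < b ^ 2 - 1 := by nlinarith
  have h3 : 0 < b ^ 2 - a ^ 2 := by nlinarith
  have amgm : ∀ x y z w : ℝ, 2 * (|x * w| * |y * z|) ≤ x ^ 2 * y ^ 2 + z ^ 2 * w ^ 2 := by
    intro x y z w
    have := sq_nonneg (|x| * |y| - |z| * |w|)
    rw [← sq_abs x, ← sq_abs y, ← sq_abs z, ← sq_abs w, abs_mul, abs_mul]
    linarith
  have h13 := amgm v₃ u₁ v₁ u₃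
  have h23 := amgm v₃ u₂ v₂ u₃
  have h12 := amgm v₁ u₂ v₂ u₁
  have e3 : |v₃ * u₃| = b * |u₁ * v₁| := by rw [mul_comm, h, abs_mul, abs_of_pos hb]
  rw [e3, mul_comm u₁ v₁] at h13 h23
  rw [mul_comm u₂ v₂] at h23 h12
  unfold reducedForm admissibleForm
  rw [h]
  have hsq : |u₁ * v₁| ^ 2 = (u₁ * v₁) ^ 2 := sq_abs _
  rw [mul_comm v₁ u₁] at *
  rw [mul_comm v₂ u₂] at *
  gcongr ?_ / _ + ?_ / _ + ?_ / _
  · have := mul_le_mul_of_nonneg_left h13 (mul_pos two_pos hb).le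
    rw [mul_assoc b, abs_mul_abs_self] at this
    rw [hsq]
    linarith
  · have := mul_le_mul_of_nonneg_left h23 hb.le
    linarith
  · refine mul_le_mul_of_nonneg_left ?_ hb.le
    linarith

/-- Cauchy-Schwarz with its defect explicit, so that the equality case |uᵢ| = |vᵢ| can be read off.
-/
theorem sum_abs_mul_eq_one_sub {u₁ u₂ u₃ v₁ v₂ v₃ : ℝ} (hu : u₁ ^ 2 + u₂ ^ 2 + u₃ ^ 2 = 1)
    (hv : v₁ ^ 2 + v₂ ^ 2 + v₃ ^ 2 = 1) :
    |u₁ * v₁| + |u₂ * v₂| + |u₃ * v₃| =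
      1 - ((|u₁| - |v₁|) ^ 2 + (|u₂| - |v₂|) ^ 2 + (|u₃| - |v₃|) ^ 2) / 2 := by
  rw [← sq_abs u₁, ← sq_abs u₂, ← sq_abs u₃] at hu
  rw [← sq_abs v₁, ← sq_abs v₂, ← sq_abs v₃] at hv
  rw [abs_mul, abs_mul, abs_mul]
  linear_combination (hu + hv) / 2

theorem minCoeff_le_admissibleForm {a b : ℝ} (ha : 1 < a) (hab : a < b)
    {u₁ u₂ u₃ v₁ v₂ v₃ : ℝ} (hu : u₁ ^ 2 + u₂ ^ 2 + u₃ ^ 2 = 1)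
    (hv : v₁ ^ 2 + v₂ ^ 2 + v₃ ^ 2 = 1) (h : u₃ * v₃ = b * (u₁ * v₁)) :
    minCoeff a b ≤ admissibleForm a b u₁ u₂ u₃ v₁ v₂ v₃ ∧
    (admissibleForm a b u₁ u₂ u₃ v₁ v₂ v₃ = minCoeff a b →
      |u₁ * v₁| = bestSq a b ∧ |u₂ * v₂| = 1 - (1 + b) * bestSq a b ∧
        u₁ * v₁ * (u₂ * v₂) = -(|u₁ * v₁| * |u₂ * v₂|)) := by
  have hN := bestDenom_pos ha hab
  have hb : 0 < b := by linarith
  have ha0 : 0 < a := by linarith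
  have hb1 : 0 < b - 1 := by linarith
  have h1 : 0 < a ^ 2 - 1 := by nlinarith
  have h3 : 0 < b ^ 2 - a ^ 2 := by nlinarith
  have hle := reducedForm_le_admissibleForm ha hab (u₂ := u₂) (v₂ := v₂) h
  rw [reducedForm_eq ha hab] at hle
  have hsum := sum_abs_mul_eq_one_sub hu hv
  have hab3 : |u₃ * v₃| = b * |u₁ * v₁| := by rw [h, abs_mul, abs_of_pos hb]
  have hslack : 0 ≤ 1 - (1 + b) * |u₁ * v₁| - |u₂ * v₂| := by
    nlinarith [sq_nonneg (|u₁| - |v₁|), sq_nonneg (|u₂| - |v₂|), sq_nonneg (|u₃| - |v₃|)]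
  have hsign : 0 ≤ |u₁ * v₁| * |u₂ * v₂| + u₁ * v₁ * (u₂ * v₂) := by
    rw [← abs_mul]
    linarith [neg_abs_le (u₁ * v₁ * (u₂ * v₂))]
  have hc1 : 0 < b * (b + 1) * (1 + a + a ^ 2 + b * (a - 1) + b ^ 2) /
      ((b - 1) * ((a + b) * (a + 1))) := by positivity
  have hc2 : 0 < a * b / (b ^ 2 - a ^ 2) + a * b / (a ^ 2 - 1) := by positivity
  have hc3 : 0 < b * (b - 1) / ((a + b) * (a + 1)) := by positivity
  have t1 := mul_nonneg hc1.le (sq_nonneg (|u₁ * v₁| - bestSq a b))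
  have t2 := mul_nonneg hc2.le hsign
  have t3 := mul_nonneg hc3.le (mul_nonneg (abs_nonneg (u₁ * v₁)) hslack)
  refine ⟨by linarith, fun heq => ?_⟩
  -- Equality forces each of the three nonnegative corrections to vanish.
  have z1 := le_antisymm (by linarith) t1
  have z2 := le_antisymm (by linarith) t2
  have z3 := le_antisymm (by linarith) t3
  have hp : |u₁ * v₁| = bestSq a b := by
    have := (mul_eq_zero.1 z1).resolve_left hc1.ne'
    exact sub_eq_zero.1 (pow_eq_zero_iff two_ne_zero |>.1 this)
  have hs := (mul_eq_zero.1 z2).resolve_left hc2.ne'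
  -- The factor p can be cancelled because p = `bestSq` > 0.
  have hr := (mul_eq_zero.1 ((mul_eq_zero.1 z3).resolve_left hc3.ne')).resolve_left
    (hp ▸ (bestSq_pos ha hab).ne')
  rw [hp] at hr
  exact ⟨hp, by linarith, by linarith⟩

/-- Here uᵢ² = vᵢ², so the arithmetic-geometric mean step is an equality, and all three corrections
in `reducedForm_eq` are zero. -/
theorem admissibleForm_eq_minCoeff {a b : ℝ} (ha : 1 < a) (hab : a < b)
    {u₁ u₂ u₃ v₁ v₂ v₃ : ℝ} (hu1 : u₁ ^ 2 = bestSq a b) (hv1 : v₁ ^ 2 = bestSq a b)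
    (hu2 : u₂ ^ 2 = 1 - (1 + b) * bestSq a b) (hv2 : v₂ ^ 2 = 1 - (1 + b) * bestSq a b)
    (hu3 : u₃ ^ 2 = b * bestSq a b) (hv3 : v₃ ^ 2 = b * bestSq a b)
    (h : u₃ * v₃ = b * (u₁ * v₁))
    (h12 : u₁ * v₁ * (u₂ * v₂) = -(bestSq a b * (1 - (1 + b) * bestSq a b))) :
    admissibleForm a b u₁ u₂ u₃ v₁ v₂ v₃ = minCoeff a b := by
  have key : admissibleForm a b u₁ u₂ u₃ v₁ v₂ v₃ =
      reducedForm a b (bestSq a b) (1 - (1 + b) * bestSq a b)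
        (-(bestSq a b * (1 - (1 + b) * bestSq a b))) := by
    have e13 : u₁ * v₁ * (u₃ * v₃) = b * bestSq a b ^ 2 := by
      rw [h]; linear_combination b * v₁ ^ 2 * hu1 + b * bestSq a b * hv1
    have e23 : u₂ * v₂ * (u₃ * v₃) = -(b * (bestSq a b * (1 - (1 + b) * bestSq a b))) := by
      rw [h]; linear_combination b * h12
    rw [admissibleForm, reducedForm, e13, e23, h12, hu1, hv1, hu2, hv2, hu3, hv3]
    ring
  rw [key, reducedForm_eq ha hab]
  ring

/-! ### Admissible pairs and the classification of minimizers -/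

theorem norm_eq_one_of_sq_sum {u : EuclideanSpace ℝ (Fin 3)}
    (hu : u 0 ^ 2 + u 1 ^ 2 + u 2 ^ 2 = 1) : ‖u‖ = 1 := by
  have := EuclideanSpace.real_norm_sq_eq u
  rw [Fin.sum_univ_three, hu] at this
  exact (sq_eq_sq₀ (norm_nonneg u) zero_le_one).1 (by rw [this, one_pow])

theorem IsAdmissible.mul_eq {a b : ℝ} (ha : 1 < a) (hab : a < b)
    {u v : EuclideanSpace ℝ (Fin 3)} (h : IsAdmissible a b u v) :
    u 2 * v 2 = b * (u 0 * v 0) := by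
  have := (distortionAlong_taylor ha hab (v := v) h.1).2.1
  rw [h.2.2.deriv] at this
  linarith

theorem signed_best_admissible {a b : ℝ} (ha : 1 < a) (hab : a < b) {ε₁ ε₂ ε₃ σ : ℝ}
    (h1 : ε₁ ^ 2 = 1) (h2 : ε₂ ^ 2 = 1) (h3 : ε₃ ^ 2 = 1) (hσ : σ ^ 2 = 1)
    {u v : EuclideanSpace ℝ (Fin 3)}
    (hu : u = !₂[ε₁ * bestU₁ a b, ε₂ * bestU₂ a b, ε₃ * bestU₃ a b])
    (hv : v = σ • !₂[ε₁ * bestU₁ a b, -(ε₂ * bestU₂ a b), ε₃ * bestU₃ a b]) :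
    IsAdmissible a b u v ∧ secondOrderCoeff a b u v = minCoeff a b := by
  have q1 := bestU₁_sq ha hab
  have q2 := bestU₂_sq ha hab
  have q3 := bestU₃_sq ha hab
  have u0 : u 0 = ε₁ * bestU₁ a b := by simp [hu]
  have u1 : u 1 = ε₂ * bestU₂ a b := by simp [hu]
  have u2 : u 2 = ε₃ * bestU₃ a b := by simp [hu]
  have v0 : v 0 = σ * (ε₁ * bestU₁ a b) := by simp [hv]
  have v1 : v 1 = -(σ * (ε₂ * bestU₂ a b)) := by simp [hv]
  have v2 : v 2 = σ * (ε₃ * bestU₃ a b) := by simp [hv]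
  have su0 : u 0 ^ 2 = bestSq a b := by rw [u0, mul_pow, h1, q1, one_mul]
  have su1 : u 1 ^ 2 = 1 - (1 + b) * bestSq a b := by rw [u1, mul_pow, h2, q2, one_mul]
  have su2 : u 2 ^ 2 = b * bestSq a b := by rw [u2, mul_pow, h3, q3, one_mul]
  have sv0 : v 0 ^ 2 = bestSq a b := by rw [v0, mul_pow, hσ, ← u0, su0, one_mul]
  have sv1 : v 1 ^ 2 = 1 - (1 + b) * bestSq a b := by
    rw [v1, neg_sq, mul_pow, hσ, ← u1, su1, one_mul]
  have sv2 : v 2 ^ 2 = b * bestSq a b := by rw [v2, mul_pow, hσ, ← u2, su2, one_mul]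
  have hnu : ‖u‖ = 1 := norm_eq_one_of_sq_sum (by rw [su0, su1, su2]; ring)
  have hnv : ‖v‖ = 1 := norm_eq_one_of_sq_sum (by rw [sv0, sv1, sv2]; ring)
  have p0 : u 0 * v 0 = σ * bestSq a b := by rw [v0, ← u0]; linear_combination σ * su0
  have p1 : u 1 * v 1 = -(σ * (1 - (1 + b) * bestSq a b)) := by
    rw [v1, ← u1]; linear_combination -σ * su1
  have p2 : u 2 * v 2 = b * (u 0 * v 0) := by
    rw [p0, v2, ← u2]; linear_combination σ * su2
  obtain ⟨hsmooth, hderiv, hcoeff⟩ := distortionAlong_taylor ha hab (v := v) hnu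
  refine ⟨⟨hnu, hnv, ?_⟩, ?_⟩
  · have := (hsmooth.differentiableAt (by simp)).hasDerivAt
    rwa [hderiv, p2, sub_self] at this
  · rw [hcoeff p2]
    refine admissibleForm_eq_minCoeff ha hab su0 sv0 su1 sv1 su2 sv2 p2 ?_
    rw [p0, p1]
    linear_combination -(bestSq a b * (1 - (1 + b) * bestSq a b)) * hσ

theorem exists_sign_of_sq_eq {x y : ℝ} (h : x ^ 2 = y ^ 2) :
    ∃ ε ∈ ({1, -1} : Set ℝ), x = ε * y := by
  rcases sq_eq_sq_iff_eq_or_eq_neg.1 h with h | h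
  · exact ⟨1, by simp, by simp [h]⟩
  · exact ⟨-1, by simp, by simp [h]⟩

theorem sq_eq_one_of_mem {ε : ℝ} (h : ε ∈ ({1, -1} : Set ℝ)) : ε ^ 2 = 1 := by
  rcases h with rfl | rfl <;> norm_num

theorem exists_signs_of_minimizer {a b : ℝ} (ha : 1 < a) (hab : a < b)
    {u v : EuclideanSpace ℝ (Fin 3)} (hadm : IsAdmissible a b u v)
    (hmin : secondOrderCoeff a b u v = minCoeff a b) :
    ∃ ε₁ ∈ ({1, -1} : Set ℝ), ∃ ε₂ ∈ ({1, -1} : Set ℝ), ∃ ε₃ ∈ ({1, -1} : Set ℝ),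
      ∃ σ ∈ ({1, -1} : Set ℝ),
        u = !₂[ε₁ * bestU₁ a b, ε₂ * bestU₂ a b, ε₃ * bestU₃ a b] ∧
        v = σ • !₂[ε₁ * bestU₁ a b, -(ε₂ * bestU₂ a b), ε₃ * bestU₃ a b] := by
  have hb : 0 < b := by linarith
  have hm := hadm.mul_eq ha hab
  have hu := sq_sum_eq_one hadm.1
  have hv := sq_sum_eq_one hadm.2.1
  rw [(distortionAlong_taylor ha hab (v := v) hadm.1).2.2 hm] at hmin
  obtain ⟨hp, hr, hs⟩ := (minCoeff_le_admissibleForm ha hab hu hv hm).2 hmin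
  have hab3 : |u 2 * v 2| = b * |u 0 * v 0| := by rw [hm, abs_mul, abs_of_pos hb]
  have hsum := sum_abs_mul_eq_one_sub hu hv
  -- The absolute products now add up to 1, so the Cauchy-Schwarz defect is zero.
  rw [hab3, hr, hp] at hsum
  have d0 := sq_nonneg (|u 0| - |v 0|)
  have d1 := sq_nonneg (|u 1| - |v 1|)
  have d2 := sq_nonneg (|u 2| - |v 2|)
  have abs_eq : ∀ {x : ℝ}, x ^ 2 = 0 → x = 0 := fun h => pow_eq_zero_iff two_ne_zero |>.1 h
  have a0 : |u 0| = |v 0| := sub_eq_zero.1 (abs_eq (le_antisymm (by linarith) d0))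
  have a1 : |u 1| = |v 1| := sub_eq_zero.1 (abs_eq (le_antisymm (by linarith) d1))
  have a2 : |u 2| = |v 2| := sub_eq_zero.1 (abs_eq (le_antisymm (by linarith) d2))
  have su0 : u 0 ^ 2 = bestU₁ a b ^ 2 := by
    rw [bestU₁_sq ha hab, ← hp, abs_mul, ← a0, abs_mul_abs_self, sq]
  have su1 : u 1 ^ 2 = bestU₂ a b ^ 2 := by
    rw [bestU₂_sq ha hab, ← hr, abs_mul, ← a1, abs_mul_abs_self, sq]
  have su2 : u 2 ^ 2 = bestU₃ a b ^ 2 := by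
    rw [bestU₃_sq ha hab, ← hp, ← hab3, abs_mul, ← a2, abs_mul_abs_self, sq]
  have sv0 : (u 0 * v 0) ^ 2 = (bestU₁ a b ^ 2) ^ 2 := by
    rw [← sq_abs, hp, bestU₁_sq ha hab]
  obtain ⟨ε₁, m1, e1⟩ := exists_sign_of_sq_eq su0
  obtain ⟨ε₂, m2, e2⟩ := exists_sign_of_sq_eq su1
  obtain ⟨ε₃, m3, e3⟩ := exists_sign_of_sq_eq su2
  -- σ is the sign of u₁v₁. Admissibility gives u₃v₃ the same sign, and s = -pr gives u₂v₂ the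
  -- opposite one.
  obtain ⟨σ, mσ, eσ⟩ := exists_sign_of_sq_eq sv0
  have n1 := sq_eq_one_of_mem m1
  have n2 := sq_eq_one_of_mem m2
  have n3 := sq_eq_one_of_mem m3
  have nσ := sq_eq_one_of_mem mσ
  obtain ⟨pos1, pos2, pos3⟩ := bestU_pos ha hab
  have key : ∀ {ε U x y τ : ℝ}, ε ^ 2 = 1 → 0 < U → x = ε * U → x * y = τ * U ^ 2 →
      y = τ * (ε * U) := by
    intro ε U x y τ hε hU hx hxy
    refine mul_left_cancel₀ hU.ne' ?_
    rw [hx] at hxy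
    linear_combination ε * hxy - U * y * hε
  have w0 : v 0 = σ * (ε₁ * bestU₁ a b) := key n1 pos1 e1 eσ
  have w1 : v 1 = -σ * (ε₂ * bestU₂ a b) := by
    refine key n2 pos2 e2 (mul_left_cancel₀ (pow_pos pos1 2).ne' ?_)
    rw [hp, hr, ← bestU₂_sq ha hab, ← bestU₁_sq ha hab, eσ] at hs
    linear_combination σ * hs - bestU₁ a b ^ 2 * (u 1 * v 1) * nσ
  have w2 : v 2 = σ * (ε₃ * bestU₃ a b) := by
    refine key n3 pos3 e3 ?_
    rw [hm, eσ, bestU₁_sq ha hab, bestU₃_sq ha hab]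
    ring
  refine ⟨ε₁, m1, ε₂, m2, ε₃, m3, σ, mσ, ?_, ?_⟩
  · ext i
    fin_cases i <;> simp [e1, e2, e3]
  · ext i
    fin_cases i <;> simp [w0, w1, w2]

theorem mainTheorem4 (a b : ℝ) (ha : 1 < a) (hab : a < b) :
    -- the distortion is smooth near `t = 0` along every unit rank-one direction
    (∀ u v : EuclideanSpace ℝ (Fin 3), ‖u‖ = 1 → ‖v‖ = 1 →
      ContDiffAt ℝ ∞ (distortionAlong a b u v) 0) ∧
    -- the explicit direction is admissible and attains the negative value `minCoeff a b`
    IsAdmissible a b !₂[bestU₁ a b, bestU₂ a b, bestU₃ a b]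
      !₂[bestU₁ a b, -bestU₂ a b, bestU₃ a b] ∧
    secondOrderCoeff a b !₂[bestU₁ a b, bestU₂ a b, bestU₃ a b]
      !₂[bestU₁ a b, -bestU₂ a b, bestU₃ a b] = minCoeff a b ∧
    minCoeff a b < 0 ∧
    -- this value is the minimum over all admissible directions
    (∀ u v : EuclideanSpace ℝ (Fin 3), IsAdmissible a b u v →
      minCoeff a b ≤ secondOrderCoeff a b u v) ∧
    -- the minimizers are exactly the sign variants of the explicit direction
    (∀ u v : EuclideanSpace ℝ (Fin 3),
      (IsAdmissible a b u v ∧ secondOrderCoeff a b u v = minCoeff a b) ↔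
        ∃ ε₁ ∈ ({1, -1} : Set ℝ), ∃ ε₂ ∈ ({1, -1} : Set ℝ), ∃ ε₃ ∈ ({1, -1} : Set ℝ),
        ∃ σ ∈ ({1, -1} : Set ℝ),
          u = !₂[ε₁ * bestU₁ a b, ε₂ * bestU₂ a b, ε₃ * bestU₃ a b] ∧
          v = σ • !₂[ε₁ * bestU₁ a b, -(ε₂ * bestU₂ a b), ε₃ * bestU₃ a b]) := by
  
  have hbest := signed_best_admissible ha hab (ε₁ := 1) (ε₂ := 1) (ε₃ := 1) (σ := 1)
    (by norm_num) (by norm_num) (by norm_num) (by norm_num)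
    (u := !₂[bestU₁ a b, bestU₂ a b, bestU₃ a b])
    (v := !₂[bestU₁ a b, -bestU₂ a b, bestU₃ a b]) (by simp) (by simp)
  refine ⟨fun u v hu _ => (distortionAlong_taylor ha hab hu).1, hbest.1, hbest.2,
    minCoeff_neg ha hab, fun u v h => ?_, fun u v => ⟨fun h => ?_, ?_⟩⟩
  · have hm := h.mul_eq ha hab
    rw [(distortionAlong_taylor ha hab (v := v) h.1).2.2 hm]
    exact (minCoeff_le_admissibleForm ha hab (sq_sum_eq_one h.1) (sq_sum_eq_one h.2.1) hm).1
  · exact exists_signs_of_minimizer ha hab h.1 h.2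
  · rintro ⟨ε₁, h1, ε₂, h2, ε₃, h3, σ, hσ, hu, hv⟩
    exact signed_best_admissible ha hab (sq_eq_one_of_mem h1) (sq_eq_one_of_mem h2)
      (sq_eq_one_of_mem h3) (sq_eq_one_of_mem hσ) hu hv
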